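/- All maps are continuous; $|\cdot|$ is the Euclidean norm, $k\ge 0$, and a map on a subset $X\subseteq\mathbb R^k$ is called smooth if it has a $C^\infty$ extension to an open neighborhood of $X$. \textbf{Degree.} Let $U\subseteq\mathbb R^k$ be open, $y\in\mathbb R^k$. (i) If $f:\overline U\to\mathbb R^k$ is proper (preimages of compact sets are compact) and $y\notin f(\partial U)$, the triple $(f,U,y)$ is \emph{admissible}. It is \emph{regular} if, moreover, $f$ is smooth on $\overline U$ and $f'(x)$ is onto for every $x\in U$ with $f(x)=y$; in this case $\deg(f,U,y):=\sum_{x\in f^{-1}(y)\cap U}\operatorname{sign}\det f'(x)$ (a finite sum). (ii) For an admissible triple, $\deg(f,U,y):=\deg(g,U,z)$, where $(g,U,z)$ is any regular triple such that, for some $\varepsilon,\sigma>0$, $|g(x)-f(x)|\le\varepsilon$ for all $x\in\overline U$, $|z-y|\le\sigma$ and $\varepsilon+\sigma<\operatorname{dist}(y,f(\partial U))$ (with $\operatorname{dist}(y,\emptyset)=+\infty$). (iii) If $f:U\to\mathbb R^k$ is continuous and $f^{-1}(y)$ is compact, the triple $(f,U,y)$ is \emph{weakly admissible}, and $\deg(f,U,y):=\deg(f,V,y)$,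 where $V$ is any bounded open neighborhood of $f^{-1}(y)$ with $\overline V\subseteq U$. \textbf{Theorem (General Homotopy Invariance).} Let $W$ be a (relatively) open subset of $\mathbb R^k\times[0,1]$, let $H:W\to\mathbb R^k$ and $\alpha:[0,1]\to\mathbb R^k$ be continuous, and suppose that $$\Sigma=\{(x,\lambda)\in W: H(x,\lambda)=\alpha(\lambda)\}$$ is compact. For $\lambda\in[0,1]$ put $W_\lambda=\{x\in\mathbb R^k:(x,\lambda)\in W\}$ and $H_\lambda=H(\cdot,\lambda):W_\lambda\to\mathbb R^k$. Then, for every $\lambda\in[0,1]$, the triple $(H_\lambda,W_\lambda,\alpha(\lambda))$ is weakly admissible and its degree in the sense of (iii) is well defined (admissible choices exist in (ii) and (iii), and the value does not depend on them), and the integer $\deg(H_\lambda,W_\lambda,\alpha(\lambda))$ does not depend on $\lambda\in[0,1]$. -/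

import Mathlib

open scoped ContDiff

namespace BrouwerDeg

variable {k : ℕ}

/-- `f` is proper on `X`: its restriction to `X` is continuous and preimages of compact sets under
this restriction are compact. -/
def IsProperOn (f : EuclideanSpace ℝ (Fin k) → EuclideanSpace ℝ (Fin k))
    (X : Set (EuclideanSpace ℝ (Fin k))) : Prop :=
  ContinuousOn f X ∧ ∀ K : Set (EuclideanSpace ℝ (Fin k)), IsCompact K → IsCompact (X ∩ f ⁻¹' K)

/-- `f` is smooth on the arbitrary set `X`: its restriction to `X` has a `C^∞` extension to an
open neighbourhood of `X`. -/
def IsSmoothOn (f : EuclideanSpace ℝ (Fin k) → EuclideanSpace ℝ (Fin k))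
    (X : Set (EuclideanSpace ℝ (Fin k))) : Prop :=
  ∃ (O : Set (EuclideanSpace ℝ (Fin k))) (F : EuclideanSpace ℝ (Fin k) → EuclideanSpace ℝ (Fin k)),
    IsOpen O ∧ X ⊆ O ∧ ContDiffOn ℝ ∞ F O ∧ Set.EqOn f F X

/-- Admissible triples. Only the values of `f` on `closure U` matter. -/
structure IsAdmissible (f : EuclideanSpace ℝ (Fin k) → EuclideanSpace ℝ (Fin k))
    (U : Set (EuclideanSpace ℝ (Fin k))) (y : EuclideanSpace ℝ (Fin k)) : Prop where
  isOpen : IsOpen U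
  proper : IsProperOn f (closure U)
  ne_frontier : ∀ x ∈ frontier U, f x ≠ y

/-- Regular triples: admissible triples with `f` smooth on `closure U` and `y` a regular value
of `f` in `U`. -/
structure IsRegular (f : EuclideanSpace ℝ (Fin k) → EuclideanSpace ℝ (Fin k))
    (U : Set (EuclideanSpace ℝ (Fin k))) (y : EuclideanSpace ℝ (Fin k)) : Prop where
  admissible : IsAdmissible f U y
  smooth : IsSmoothOn f (closure U)
  regular : ∀ x ∈ U, f x = y → Function.Surjective (fderiv ℝ f x)

/-- The index of `f` at `x`: the sign of the Jacobian determinant. -/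
noncomputable def index (f : EuclideanSpace ℝ (Fin k) → EuclideanSpace ℝ (Fin k))
    (x : EuclideanSpace ℝ (Fin k)) : ℤ :=
  (SignType.sign (fderiv ℝ f x).det : ℤ)

/-- The degree of a regular triple: the sum of the indices over the set `U ∩ f ⁻¹' {y}`, which is
finite for a regular triple. -/
noncomputable def regularDegree (f : EuclideanSpace ℝ (Fin k) → EuclideanSpace ℝ (Fin k))
    (U : Set (EuclideanSpace ℝ (Fin k))) (y : EuclideanSpace ℝ (Fin k)) : ℤ :=
  ∑ᶠ x ∈ U ∩ f ⁻¹' {y}, index f x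

/-- `(g, U, z)` is a regular triple with `g` `ε`-close to `f` on `closure U`, `z` `σ`-close to `y`
and `ε + σ < dist (y, f (∂U))`, for some `ε, σ > 0`. The distance is extended-valued, so that the
distance to the empty set is infinite. -/
def IsRegularApprox (f : EuclideanSpace ℝ (Fin k) → EuclideanSpace ℝ (Fin k))
    (U : Set (EuclideanSpace ℝ (Fin k))) (y : EuclideanSpace ℝ (Fin k))
    (g : EuclideanSpace ℝ (Fin k) → EuclideanSpace ℝ (Fin k))
    (z : EuclideanSpace ℝ (Fin k)) : Prop :=
  IsRegular g U z ∧ ∃ ε σ : ℝ, 0 < ε ∧ 0 < σ ∧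
    (∀ x ∈ closure U, ‖g x - f x‖ ≤ ε) ∧ ‖z - y‖ ≤ σ ∧
    ENNReal.ofReal (ε + σ) < Metric.infEDist y (f '' frontier U)

/-- `d` is the degree of the admissible triple `(f, U, y)`: regular approximations exist, and
every one of them has degree `d`. -/
def HasAdmissibleDegree (f : EuclideanSpace ℝ (Fin k) → EuclideanSpace ℝ (Fin k))
    (U : Set (EuclideanSpace ℝ (Fin k))) (y : EuclideanSpace ℝ (Fin k)) (d : ℤ) : Prop :=
  IsAdmissible f U y ∧ (∃ g z, IsRegularApprox f U y g z) ∧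
    ∀ g z, IsRegularApprox f U y g z → regularDegree g U z = d

/-- Weakly admissible triples. Only the values of `f` on `U` matter. -/
structure IsWeaklyAdmissible (f : EuclideanSpace ℝ (Fin k) → EuclideanSpace ℝ (Fin k))
    (U : Set (EuclideanSpace ℝ (Fin k))) (y : EuclideanSpace ℝ (Fin k)) : Prop where
  isOpen : IsOpen U
  continuousOn : ContinuousOn f U
  compact : IsCompact (U ∩ f ⁻¹' {y})

/-- `V` is a bounded open neighbourhood of the solution set `U ∩ f ⁻¹' {y}` whose closure is
contained in `U`. -/
def IsSolutionNhd (f : EuclideanSpace ℝ (Fin k) → EuclideanSpace ℝ (Fin k))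
    (U : Set (EuclideanSpace ℝ (Fin k))) (y : EuclideanSpace ℝ (Fin k))
    (V : Set (EuclideanSpace ℝ (Fin k))) : Prop :=
  IsOpen V ∧ Bornology.IsBounded V ∧ U ∩ f ⁻¹' {y} ⊆ V ∧ closure V ⊆ U

/-- `d` is the (extended) Brouwer degree of the weakly admissible triple `(f, U, y)`: bounded open
neighbourhoods `V` of the solution set with closure in `U` exist, and for every one of them `d` is
the degree of the admissible triple `(f, V, y)`. -/
def HasDegree (f : EuclideanSpace ℝ (Fin k) → EuclideanSpace ℝ (Fin k))
    (U : Set (EuclideanSpace ℝ (Fin k))) (y : EuclideanSpace ℝ (Fin k)) (d : ℤ) : Prop :=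
  IsWeaklyAdmissible f U y ∧ (∃ V, IsSolutionNhd f U y V) ∧
    ∀ V, IsSolutionNhd f U y V → HasAdmissibleDegree f V y d

open Classical in
/-- The (extended) Brouwer degree `deg (f, U, y)`; the value `0` is used if there is none. -/
noncomputable def degree (f : EuclideanSpace ℝ (Fin k) → EuclideanSpace ℝ (Fin k))
    (U : Set (EuclideanSpace ℝ (Fin k))) (y : EuclideanSpace ℝ (Fin k)) : ℤ :=
  if h : ∃ d, HasDegree f U y d then h.choose else 0

theorem HasDegree.unique {f : EuclideanSpace ℝ (Fin k) → EuclideanSpace ℝ (Fin k)}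
    {U : Set (EuclideanSpace ℝ (Fin k))} {y : EuclideanSpace ℝ (Fin k)} {d e : ℤ}
    (hd : HasDegree f U y d) (he : HasDegree f U y e) : d = e := by
  obtain ⟨V, hV⟩ := hd.2.1
  obtain ⟨g, z, hg⟩ := (hd.2.2 V hV).2.1
  exact ((hd.2.2 V hV).2.2 g z hg).symm.trans ((he.2.2 V hV).2.2 g z hg)

theorem HasDegree.degree_eq {f : EuclideanSpace ℝ (Fin k) → EuclideanSpace ℝ (Fin k)}
    {U : Set (EuclideanSpace ℝ (Fin k))} {y : EuclideanSpace ℝ (Fin k)} {d : ℤ}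
    (hd : HasDegree f U y d) : degree f U y = d := by
  have h : ∃ d, HasDegree f U y d := ⟨d, hd⟩
  rw [degree, dif_pos h]
  exact h.choose_spec.unique hd

/-- The slice `W_t = {x | (x, t) ∈ W}`. -/
def slice (W : Set (EuclideanSpace ℝ (Fin k) × unitInterval)) (t : unitInterval) :
    Set (EuclideanSpace ℝ (Fin k)) :=
  {x | (x, t) ∈ W}

end BrouwerDeg

/-! For bounded V and a regular triple (g, V, z), the degree equals the integral over V of φ(g - z)
det g', for every continuous φ of integral one supported close enough to 0: a change of variables
makes each zero contribute the sign of its Jacobian (`eventually_setIntegral_eq_finsum`). Unlike the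
count of zeros, this integral is visibly invariant under affine homotopies that keep the image of
the frontier off the support of φ: its derivative in the homotopy parameter is the integral of the
divergence of a compactly supported field (`setIntegral_divergence_eq_zero`,
`setIntegral_homotopy`). Any two regular approximations of one triple are joined by such a homotopy,
so the degree does not depend on the choice (`IsRegularApprox.regularDegree_eq`); smoothing and
Sard's theorem provide approximations.

Excision makes the degree independent of the neighbourhood in the weakly admissible case, and an
approximation shared by two nearby triples gives stability under small perturbations. Compactness of
the solution set lets one neighbourhood V serve all parameters near a given one
(`HasDegree.eventually_eq`), so the degree is locally constant on the connected unit interval. -/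

namespace BrouwerDeg

open MeasureTheory Set Filter Topology

/-! ### Determinant identities and integrals of derivatives -/

section

variable {ι E : Type*} [Fintype ι] [DecidableEq ι] [NormedAddCommGroup E] [NormedSpace ℝ E]

/-- The determinant with respect to a basis, as a continuous alternating map. -/
noncomputable def detAlt [FiniteDimensional ℝ E] (b : Module.Basis ι ℝ E) : E [⋀^ι]→L[ℝ] ℝ :=
  { b.det with
    cont := by
      change Continuous fun v : ι → E => b.det v
      simp only [Module.Basis.det_apply]
      refine Continuous.matrix_det (continuous_matrix fun i j => ?_)
      exact (LinearMap.continuous_of_finiteDimensional (b.coord i)).comp (continuous_apply j) }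

theorem detAlt_apply [FiniteDimensional ℝ E] (b : Module.Basis ι ℝ E) (v : ι → E) :
    detAlt b v = b.det v := rfl

theorem detAlt_comp_basis [FiniteDimensional ℝ E] (b : Module.Basis ι ℝ E) (A : E →L[ℝ] E) :
    detAlt b (fun i => A (b i)) = A.det := by
  rw [detAlt_apply]
  simpa [Function.comp_def] using b.det_comp_basis b (A : E →ₗ[ℝ] E)

/-- Cramer's rule, for the determinant with respect to a basis. -/
theorem sum_detAlt_update_smul [FiniteDimensional ℝ E] (b : Module.Basis ι ℝ E) (v : ι → E)
    (h : E) : ∑ i, detAlt b (Function.update v i h) • v i = detAlt b v • h := by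
  apply b.equivFun.injective
  have key := Matrix.mulVec_cramer (b.toMatrix v) (b.equivFun h)
  have h1 : ∀ i, detAlt b (Function.update v i h)
      = Matrix.cramer (b.toMatrix v) (b.equivFun h) i := by
    intro i
    rw [detAlt_apply, Module.Basis.det_apply, Matrix.cramer_apply, Module.Basis.toMatrix_update]
    rfl
  simp only [map_sum, map_smul, h1]
  rw [detAlt_apply, Module.Basis.det_apply, ← key]
  ext j
  simp [Matrix.mulVec, dotProduct, Module.Basis.toMatrix_apply, mul_comm]

/-- The terms (i, j) and (j, i) differ by a transposition of two arguments of `D`, hence by a sign.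
With `S` the second derivative of a map, this is the classical fact that the rows of the cofactor
matrix are divergence free. -/
theorem sum_sum_update_eq_zero (D : E [⋀^ι]→L[ℝ] ℝ) (v : ι → E) (h : E) (S : ι → ι → E)
    (hS : ∀ i j, S i j = S j i) :
    ∑ i, ∑ j ∈ Finset.univ.erase i,
      D (Function.update (Function.update v i h) j (S i j)) = 0 := by
  have hanti : ∀ i j, i ≠ j → D (Function.update (Function.update v i h) j (S i j)) =
      - D (Function.update (Function.update v j h) i (S j i)) := by
    intro i j hij
    rw [hS]
    refine Eq.trans ?_ (D.toAlternatingMap.map_swap _ hij)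
    change D _ = D _
    congr 1
    ext l
    by_cases hi : l = i
    · subst hi; simp [hij, hij.symm]
    · by_cases hj : l = j
      · subst hj; simp
      · simp [hi, hj, Equiv.swap_apply_of_ne_of_ne]
  have hif : ∀ i, ∑ j ∈ Finset.univ.erase i,
      D (Function.update (Function.update v i h) j (S i j)) =
      ∑ j, if i ≠ j then D (Function.update (Function.update v i h) j (S i j)) else 0 := by
    intro i
    rw [← Finset.sum_filter]
    congr 1
    ext j
    simp [eq_comm]
  simp only [hif]
  set T : ι → ι → ℝ := fun i j =>
    if i ≠ j then D (Function.update (Function.update v i h) j (S i j)) else 0 with hT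
  have hTanti : ∀ i j, T i j = - T j i := by
    intro i j
    by_cases hij : i = j
    · simp [hT, hij]
    · simp only [hT, ne_eq, hij, not_false_eq_true, if_true, Ne.symm hij]
      exact hanti i j hij
  have : ∑ i, ∑ j, T i j = - ∑ i, ∑ j, T i j := by
    conv_rhs => rw [Finset.sum_comm]
    simp only [← Finset.sum_neg_distrib]
    exact Finset.sum_congr rfl fun i _ => Finset.sum_congr rfl fun j _ => hTanti i j
  linarith

theorem integral_fderiv_apply_eq_zero [FiniteDimensional ℝ E] [MeasurableSpace E] [BorelSpace E]
    (μ : Measure E) [μ.IsAddHaarMeasure] {v : E → ℝ} (hv : ContDiff ℝ 1 v)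
    (hc : HasCompactSupport v) (e : E) : ∫ x, fderiv ℝ v x e ∂μ = 0 := by
  have h := integral_mul_fderiv_eq_neg_fderiv_mul_of_integrable (μ := μ) (f := fun _ : E => (1 : ℝ))
    (g := v) (v := e) (by simp) ?_ ?_ (by fun_prop)
    (fun x _ => hv.differentiable one_ne_zero x)
  · simpa using h
  · simp only [one_mul]
    refine Continuous.integrable_of_hasCompactSupport ?_ ?_
    · exact (hv.continuous_fderiv one_ne_zero).clm_apply continuous_const
    · exact hc.fderiv_apply (𝕜 := ℝ) e
  · simpa using hv.continuous.integrable_of_hasCompactSupport hc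

end

/-! ### The divergence identity -/

section

/-- Turns the updated tuple into a family of maps evaluated at one point, the form required by the
differentiation rule for multilinear maps. -/
theorem update_apply_eq {ι E : Type*} [DecidableEq ι] (G : ι → E → E) (i : ι) (h : E → E) (x : E) :
    Function.update (fun j => G j x) i (h x) = fun j => Function.update G i h j x := by
  ext j
  by_cases hj : j = i
  · subst hj; simp
  · simp [hj]

variable {ι E : Type*} [Fintype ι] [DecidableEq ι] [NormedAddCommGroup E] [NormedSpace ℝ E]

theorem contDiffOn_detAlt_update [FiniteDimensional ℝ E] (b : Module.Basis ι ℝ E) {V : Set E}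
    (hV : IsOpen V) {g h : E → E} (hg : ContDiffOn ℝ ∞ g V) (hh : ContDiffOn ℝ ∞ h V) (i : ι) :
    ContDiffOn ℝ ∞
      (fun x => detAlt b (Function.update (fun j => fderiv ℝ g x (b j)) i (h x))) V := by
  have hg' : ContDiffOn ℝ ∞ (fderiv ℝ g) V := hg.fderiv_of_isOpen hV (by simp)
  simp only [update_apply_eq (fun j x => fderiv ℝ g x (b j))]
  refine (detAlt b).toContinuousMultilinearMap.contDiff.comp_contDiffOn ?_
  rw [contDiffOn_pi]
  intro j
  by_cases hj : j = i
  · subst hj; simpa using hh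
  · simpa [hj] using hg'.clm_apply contDiffOn_const

theorem fderiv_detAlt_update_apply [FiniteDimensional ℝ E] (b : Module.Basis ι ℝ E) {V : Set E}
    (hV : IsOpen V) {g h : E → E} (hg : ContDiffOn ℝ ∞ g V) (hh : ContDiffOn ℝ ∞ h V)
    {x : E} (hx : x ∈ V) (i : ι) (e : E) :
    fderiv ℝ (fun x => detAlt b (Function.update (fun j => fderiv ℝ g x (b j)) i (h x))) x e =
      detAlt b (Function.update (fun j => fderiv ℝ g x (b j)) i (fderiv ℝ h x e)) +
      ∑ j ∈ Finset.univ.erase i,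
        detAlt b (Function.update (Function.update (fun j => fderiv ℝ g x (b j)) i (h x)) j
          (fderiv ℝ (fderiv ℝ g) x e (b j))) := by
  have hg' : ContDiffOn ℝ ∞ (fderiv ℝ g) V := hg.fderiv_of_isOpen hV (by simp)
  have dg : HasFDerivAt (fderiv ℝ g) (fderiv ℝ (fderiv ℝ g) x) x :=
    ((hg'.contDiffAt (hV.mem_nhds hx)).differentiableAt (by simp)).hasFDerivAt
  have dh : HasFDerivAt h (fderiv ℝ h x) x :=
    ((hh.contDiffAt (hV.mem_nhds hx)).differentiableAt (by simp)).hasFDerivAt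
  have key := HasFDerivAt.multilinear_comp (detAlt b).toContinuousMultilinearMap
    (g := Function.update (fun j x => fderiv ℝ g x (b j)) i h)
    (g' := Function.update (fun j => (fderiv ℝ (fderiv ℝ g) x).flip (b j)) i (fderiv ℝ h x))
    (x := x) (by
      intro j
      by_cases hj : j = i
      · subst hj; simpa using dh
      · simp only [ne_eq, hj, not_false_eq_true, Function.update_of_ne]
        simpa using dg.clm_apply (hasFDerivAt_const (b j) x))
  simp only [update_apply_eq (fun j x => fderiv ℝ g x (b j))]
  have := key.fderiv
  simp only [ContinuousAlternatingMap.coe_toContinuousMultilinearMap] at this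
  rw [this, ← Finset.add_sum_erase _ _ (Finset.mem_univ i)]
  simp only [_root_.add_apply, _root_.sum_apply,
    ContinuousLinearMap.comp_apply, ContinuousMultilinearMap.toContinuousLinearMap_apply,
    ContinuousAlternatingMap.coe_toContinuousMultilinearMap,
    ← update_apply_eq (fun j x => fderiv ℝ g x (b j)), Function.update_self,
    Function.update_idem]
  congr 1
  refine Finset.sum_congr rfl fun j hj => ?_
  simp [Finset.ne_of_mem_erase hj]

/-- Extension by zero of a smooth function vanishing off a compact subset. -/
theorem contDiff_indicator {V K : Set E} (hV : IsOpen V) (hK : IsClosed K) (hKV : K ⊆ V)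
    {f : E → ℝ} (hf : ContDiffOn ℝ ∞ f V) (h0 : ∀ x ∈ V, x ∉ K → f x = 0) :
    ContDiff ℝ ∞ (V.indicator f) := by
  rw [contDiff_iff_contDiffAt]
  intro x
  by_cases hx : x ∈ V
  · refine (hf.contDiffAt (hV.mem_nhds hx)).congr_of_eventuallyEq ?_
    filter_upwards [hV.mem_nhds hx] with y hy using indicator_of_mem hy f
  · have hxK : x ∈ Kᶜ := fun h => hx (hKV h)
    refine (contDiffAt_const (c := (0 : ℝ))).congr_of_eventuallyEq ?_
    filter_upwards [hK.isOpen_compl.mem_nhds hxK] with y hy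
    by_cases hyV : y ∈ V
    · rw [indicator_of_mem hyV, h0 y hyV hy]
    · exact indicator_of_notMem hyV f

/-- The integrand is the divergence of the field whose i-th component is φ(g) times the determinant
of g' with column i replaced by h. In the product rule the φ' terms collapse by Cramer's rule, the
second derivatives of g cancel by antisymmetry, and the derivatives of h remain. The field vanishes
off `K`, so its extension by zero is smooth with compact support. -/
theorem setIntegral_divergence_eq_zero [FiniteDimensional ℝ E] [MeasurableSpace E] [BorelSpace E]
    (μ : Measure E) [μ.IsAddHaarMeasure] (b : Module.Basis ι ℝ E) {V K : Set E}
    (hV : IsOpen V) (hK : IsCompact K) (hKV : K ⊆ V)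
    {g h : E → E} (hg : ContDiffOn ℝ ∞ g V) (hh : ContDiffOn ℝ ∞ h V)
    {φ : E → ℝ} (hφ : ContDiff ℝ ∞ φ) (h0 : ∀ x ∈ V, x ∉ K → φ (g x) = 0) :
    ∫ x in V, (fderiv ℝ φ (g x) (h x) * detAlt b (fun i => fderiv ℝ g x (b i)) +
      φ (g x) * ∑ i, detAlt b
        (Function.update (fun j => fderiv ℝ g x (b j)) i (fderiv ℝ h x (b i)))) ∂μ = 0 := by
  set w : ι → E → ℝ := fun i x =>
    φ (g x) * detAlt b (Function.update (fun j => fderiv ℝ g x (b j)) i (h x)) with hw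
  have hwV : ∀ i, ContDiffOn ℝ ∞ (w i) V := fun i =>
    (hφ.comp_contDiffOn hg).mul (contDiffOn_detAlt_update b hV hg hh i)
  have hw0 : ∀ i, ∀ x ∈ V, x ∉ K → w i x = 0 := fun i x hx hxK => by simp [hw, h0 x hx hxK]
  have hsm : ∀ i, ContDiff ℝ ∞ (V.indicator (w i)) := fun i =>
    contDiff_indicator hV hK.isClosed hKV (hwV i) (hw0 i)
  have hcs : ∀ i, HasCompactSupport (V.indicator (w i)) := fun i =>
    HasCompactSupport.intro hK fun x hx => by
      by_cases hxV : x ∈ V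
      · rw [indicator_of_mem hxV, hw0 i x hxV hx]
      · exact indicator_of_notMem hxV _
  have hint : ∀ i, ∫ x, fderiv ℝ (V.indicator (w i)) x (b i) ∂μ = 0 := fun i =>
    integral_fderiv_apply_eq_zero μ ((hsm i).of_le (by simp)) (hcs i) (b i)
  have hI : ∀ i, Integrable (fun x => fderiv ℝ (V.indicator (w i)) x (b i)) μ := fun i =>
    (((hsm i).continuous_fderiv (by simp)).clm_apply continuous_const
      ).integrable_of_hasCompactSupport ((hcs i).fderiv_apply (𝕜 := ℝ) (b i))
  have hsum : ∫ x, ∑ i, fderiv ℝ (V.indicator (w i)) x (b i) ∂μ = 0 := by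
    rw [integral_finsetSum _ fun i _ => hI i]
    exact Finset.sum_eq_zero fun i _ => hint i
  rw [← hsum, ← integral_indicator hV.measurableSet]
  congr 1
  ext x
  by_cases hx : x ∈ V
  swap
  · rw [indicator_of_notMem hx]
    have hxK : x ∈ Kᶜ := fun h => hx (hKV h)
    refine (Finset.sum_eq_zero fun i _ => ?_).symm
    have : V.indicator (w i) =ᶠ[𝓝 x] fun _ => 0 := by
      filter_upwards [hK.isClosed.isOpen_compl.mem_nhds hxK] with y hy
      by_cases hyV : y ∈ V
      · rw [indicator_of_mem hyV, hw0 i y hyV hy]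
      · exact indicator_of_notMem hyV _
    rw [this.fderiv_eq]
    simp
  rw [indicator_of_mem hx]
  have hdw : ∀ i, fderiv ℝ (V.indicator (w i)) x = fderiv ℝ (w i) x := fun i => by
    refine Filter.EventuallyEq.fderiv_eq ?_
    filter_upwards [hV.mem_nhds hx] with y hy using indicator_of_mem hy _
  have hgx := hg.contDiffAt (hV.mem_nhds hx)
  have dg : DifferentiableAt ℝ g x := hgx.differentiableAt (by simp)
  have dφ : DifferentiableAt ℝ φ (g x) := hφ.differentiable (by simp) _
  have hsymm : ∀ i j, fderiv ℝ (fderiv ℝ g) x (b i) (b j) = fderiv ℝ (fderiv ℝ g) x (b j) (b i) :=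
    fun i j => (hgx.isSymmSndFDerivAt (by simpa using ENat.LEInfty.out)).eq _ _
  have hfd : ∀ i, fderiv ℝ (w i) x (b i) =
      fderiv ℝ φ (g x) (fderiv ℝ g x (b i)) *
        detAlt b (Function.update (fun j => fderiv ℝ g x (b j)) i (h x)) +
      φ (g x) * (detAlt b (Function.update (fun j => fderiv ℝ g x (b j)) i (fderiv ℝ h x (b i))) +
      ∑ j ∈ Finset.univ.erase i,
        detAlt b (Function.update (Function.update (fun j => fderiv ℝ g x (b j)) i (h x)) j
          (fderiv ℝ (fderiv ℝ g) x (b i) (b j)))) := by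
    intro i
    have d1 : DifferentiableAt ℝ (fun x => φ (g x)) x := dφ.comp x dg
    have d2 := ((contDiffOn_detAlt_update b hV hg hh i).contDiffAt
      (hV.mem_nhds hx)).differentiableAt (by simp)
    rw [hw]
    simp only
    rw [fderiv_fun_mul d1 d2]
    simp only [_root_.add_apply, _root_.smul_apply, smul_eq_mul]
    rw [fderiv_detAlt_update_apply b hV hg hh hx, add_comm]
    have : fderiv ℝ (fun x => φ (g x)) x = (fderiv ℝ φ (g x)).comp (fderiv ℝ g x) :=
      fderiv_comp x dφ dg
    rw [this]
    simp only [ContinuousLinearMap.comp_apply]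
    ring
  simp only [hdw, hfd, mul_add, Finset.sum_add_distrib]
  rw [← Finset.mul_sum, ← Finset.mul_sum, sum_sum_update_eq_zero (detAlt b) _ _ _ hsymm]
  have hc := congrArg (fderiv ℝ φ (g x))
    (sum_detAlt_update_smul b (fun i => fderiv ℝ g x (b i)) (h x))
  simp only [map_sum, map_smul, smul_eq_mul] at hc
  simp only [mul_comm (fderiv ℝ φ (g x) _) (detAlt b _), hc]
  ring

end

/-! ### Homotopy invariance of the integral -/

section

variable {ι E : Type*} [Fintype ι] [DecidableEq ι] [NormedAddCommGroup E] [NormedSpace ℝ E]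

theorem hasDerivAt_mul_detAlt [FiniteDimensional ℝ E] (b : Module.Basis ι ℝ E) {φ : E → ℝ}
    (hφ : ContDiff ℝ ∞ φ) (u v : E) (A B : E →L[ℝ] E) (t : ℝ) :
    HasDerivAt (fun t : ℝ => φ (u + t • v) * detAlt b (fun i => (A + t • B) (b i)))
      (fderiv ℝ φ (u + t • v) v * detAlt b (fun i => (A + t • B) (b i)) +
        φ (u + t • v) * ∑ i, detAlt b (Function.update (fun j => (A + t • B) (b j)) i (B (b i))))
      t := by
  have h1 : HasDerivAt (fun t : ℝ => u + t • v) v t := by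
    simpa using ((hasDerivAt_id t).smul_const v).const_add u
  have h2 : HasDerivAt (fun t : ℝ => fun i => (A + t • B) (b i)) (fun i => B (b i)) t := by
    rw [hasDerivAt_pi]
    intro i
    simpa using ((hasDerivAt_id t).smul_const (B (b i))).const_add (A (b i))
  have h3 := ((hφ.differentiable (by simp) (u + t • v)).hasFDerivAt).comp_hasDerivAt t h1
  have h4 := ((detAlt b).toContinuousMultilinearMap.hasFDerivAt
    (fun i => (A + t • B) (b i))).comp_hasDerivAt t h2
  have := h3.mul h4
  simp only [ContinuousMultilinearMap.linearDeriv_apply] at this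
  exact this

/-- Homotopy invariance of the integral `∫ φ(g) det g'` under affine homotopies. -/
theorem setIntegral_homotopy [FiniteDimensional ℝ E] [MeasurableSpace E] [BorelSpace E]
    (μ : Measure E) [μ.IsAddHaarMeasure] (b : Module.Basis ι ℝ E) {V : Set E}
    (hV : IsOpen V) (hVc : IsCompact (closure V)) {f h : E → E}
    (hfc : ContinuousOn f (closure V)) (hhc : ContinuousOn h (closure V))
    (hf : ContDiffOn ℝ ∞ f V) (hh : ContDiffOn ℝ ∞ h V)
    {φ : E → ℝ} (hφ : ContDiff ℝ ∞ φ)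
    (hfr : ∀ t ∈ Icc (0 : ℝ) 1, ∀ x ∈ frontier V, f x + t • h x ∉ tsupport φ) :
    ∫ x in V, φ (f x + h x) * (fderiv ℝ (fun x => f x + h x) x).det ∂μ =
      ∫ x in V, φ (f x) * (fderiv ℝ f x).det ∂μ := by
  -- All points that some stage of the homotopy sends into the support of φ. It is compact, and it
  -- stays inside V because the frontier is avoided. Derivatives are controlled only inside V,
  -- possibly not up to the frontier, so every integral is moved to `K`.
  set K : Set E := Prod.fst ''
    ((closure V ×ˢ Icc (0 : ℝ) 1) ∩ (fun p : E × ℝ => f p.1 + p.2 • h p.1) ⁻¹' tsupport φ) with hKd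
  have hGc : ContinuousOn (fun p : E × ℝ => f p.1 + p.2 • h p.1) (closure V ×ˢ Icc (0 : ℝ) 1) := by
    have h1 : ContinuousOn (fun p : E × ℝ => f p.1) (closure V ×ˢ Icc (0 : ℝ) 1) :=
      hfc.comp continuousOn_fst fun p hp => hp.1
    have h2 : ContinuousOn (fun p : E × ℝ => h p.1) (closure V ×ˢ Icc (0 : ℝ) 1) :=
      hhc.comp continuousOn_fst fun p hp => hp.1
    exact h1.add (continuousOn_snd.smul h2)
  have hK : IsCompact K := by
    refine IsCompact.image ?_ continuous_fst
    exact (hVc.prod isCompact_Icc).of_isClosed_subset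
      (hGc.preimage_isClosed_of_isClosed (isClosed_closure.prod isClosed_Icc)
        (isClosed_tsupport φ)) inter_subset_left
  have hKV : K ⊆ V := by
    rintro _ ⟨⟨x, t⟩, ⟨⟨hx, ht⟩, hxt⟩, rfl⟩
    by_contra hxV
    exact hfr t ht x ⟨hx, by rwa [hV.interior_eq]⟩ hxt
  have hoff : ∀ t ∈ Icc (0 : ℝ) 1, ∀ x ∈ V, x ∉ K → f x + t • h x ∉ tsupport φ :=
    fun t ht x hx hxK hxt => hxK ⟨(x, t), ⟨⟨subset_closure hx, ht⟩, hxt⟩, rfl⟩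
  set Q : E → ℝ → ℝ := fun x t =>
    φ (f x + t • h x) * detAlt b (fun i => (fderiv ℝ f x + t • fderiv ℝ h x) (b i)) with hQ
  set D : E → ℝ → ℝ := fun x t =>
    fderiv ℝ φ (f x + t • h x) (h x) *
      detAlt b (fun i => (fderiv ℝ f x + t • fderiv ℝ h x) (b i)) +
    φ (f x + t • h x) * ∑ i, detAlt b
      (Function.update (fun j => (fderiv ℝ f x + t • fderiv ℝ h x) (b j)) i
        (fderiv ℝ h x (b i))) with hD
  have hQD : ∀ x t, HasDerivAt (Q x) (D x t) t := fun x t => hasDerivAt_mul_detAlt b hφ _ _ _ _ t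
  have hS : MapsTo Prod.fst (K ×ˢ Icc (0 : ℝ) 1) V := fun p hp => hKV hp.1
  have cf : ContinuousOn (fun p : E × ℝ => f p.1) (K ×ˢ Icc (0 : ℝ) 1) :=
    hf.continuousOn.comp continuousOn_fst hS
  have ch : ContinuousOn (fun p : E × ℝ => h p.1) (K ×ˢ Icc (0 : ℝ) 1) :=
    hh.continuousOn.comp continuousOn_fst hS
  have cf' : ContinuousOn (fun p : E × ℝ => fderiv ℝ f p.1) (K ×ˢ Icc (0 : ℝ) 1) :=
    (hf.continuousOn_fderiv_of_isOpen hV (by simp)).comp continuousOn_fst hS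
  have ch' : ContinuousOn (fun p : E × ℝ => fderiv ℝ h p.1) (K ×ˢ Icc (0 : ℝ) 1) :=
    (hh.continuousOn_fderiv_of_isOpen hV (by simp)).comp continuousOn_fst hS
  have cG : ContinuousOn (fun p : E × ℝ => f p.1 + p.2 • h p.1) (K ×ˢ Icc (0 : ℝ) 1) :=
    cf.add (continuousOn_snd.smul ch)
  have cA : ContinuousOn (fun p : E × ℝ => fun i =>
      (fderiv ℝ f p.1 + p.2 • fderiv ℝ h p.1) (b i)) (K ×ˢ Icc (0 : ℝ) 1) :=
    continuousOn_pi.2 fun i => (cf'.add (continuousOn_snd.smul ch')).clm_apply continuousOn_const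
  have cdet : Continuous (detAlt b) := (detAlt b).cont
  have cQ : ContinuousOn (fun p : E × ℝ => Q p.1 p.2) (K ×ˢ Icc (0 : ℝ) 1) :=
    (hφ.continuous.comp_continuousOn cG).mul (cdet.comp_continuousOn cA)
  have cD : ContinuousOn (fun p : E × ℝ => D p.1 p.2) (K ×ˢ Icc (0 : ℝ) 1) := by
    refine ContinuousOn.add ?_ ?_
    · exact ((((hφ.continuous_fderiv (by simp)).comp_continuousOn cG)).clm_apply ch).mul
        (cdet.comp_continuousOn cA)
    · refine (hφ.continuous.comp_continuousOn cG).mul (continuousOn_finsetSum _ fun i _ => ?_)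
      have cB : ContinuousOn (fun p : E × ℝ => fderiv ℝ h p.1 (b i)) (K ×ˢ Icc (0 : ℝ) 1) :=
        ch'.clm_apply continuousOn_const
      exact cdet.comp_continuousOn fun p hp => Filter.Tendsto.update (cA p hp) i (cB p hp)
  have hQint : ∀ t ∈ Icc (0 : ℝ) 1, IntegrableOn (fun x => Q x t) K μ := fun t ht =>
    (cQ.comp (f := fun x => (x, t)) (by fun_prop) fun x hx => ⟨hx, ht⟩ :
      ContinuousOn (fun x => Q x t) K).integrableOn_compact hK
  have hVK : ∀ F : E → ℝ, (∀ x ∈ V, x ∉ K → F x = 0) → ∫ x in V, F x ∂μ = ∫ x in K, F x ∂μ :=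
    fun F hF => setIntegral_eq_of_subset_of_forall_sdiff_eq_zero hV.measurableSet hKV
      fun x hx => hF x hx.1 hx.2
  have hφ0 : ∀ t ∈ Icc (0 : ℝ) 1, ∀ x ∈ V, x ∉ K → φ (f x + t • h x) = 0 :=
    fun t ht x hx hxK => image_eq_zero_of_notMem_tsupport (hoff t ht x hx hxK)
  have hfd : ∀ t : ℝ, ∀ x ∈ V, fderiv ℝ (fun x => f x + t • h x) x =
      fderiv ℝ f x + t • fderiv ℝ h x := by
    intro t x hx
    have d1 := (hf.contDiffAt (hV.mem_nhds hx)).differentiableAt (by simp)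
    have d2 := (hh.contDiffAt (hV.mem_nhds hx)).differentiableAt (by simp)
    exact (d1.hasFDerivAt.add (d2.hasFDerivAt.const_smul t)).fderiv
  -- Since h is the t-derivative of f + t h, the function `D` at time t is exactly the divergence
  -- expression for g = f + t h.
  have hzero : ∀ t ∈ Icc (0 : ℝ) 1, ∫ x in K, D x t ∂μ = 0 := by
    intro t ht
    rw [← hVK]
    · have := setIntegral_divergence_eq_zero μ b hV hK hKV
        (hf.add (contDiffOn_const (c := t) |>.smul hh)) hh hφ (hφ0 t ht)
      rw [← this]
      refine setIntegral_congr_fun hV.measurableSet fun x hx => ?_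
      have e := hfd t x hx
      simp only [hD]
      change _ = fderiv ℝ φ (f x + t • h x) (h x) *
          detAlt b (fun i => fderiv ℝ (fun x => f x + t • h x) x (b i)) +
        φ (f x + t • h x) * ∑ i, detAlt b
          (Function.update (fun j => fderiv ℝ (fun x => f x + t • h x) x (b j)) i
            (fderiv ℝ h x (b i)))
      rw [e]
    · intro x hx hxK
      have : fderiv ℝ φ (f x + t • h x) = 0 := by
        by_contra hne
        exact hoff t ht x hx hxK (support_fderiv_subset ℝ hne)
      simp [hD, this, hφ0 t ht x hx hxK]
  have hDint : Integrable (Function.uncurry D)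
      ((μ.restrict K).prod (volume.restrict (Ioc (0 : ℝ) 1))) := by
    rw [Measure.prod_restrict]
    exact (ContinuousOn.integrableOn_compact (μ := μ.prod volume) (hK.prod isCompact_Icc) cD).mono_set
      (prod_mono_right Ioc_subset_Icc_self)
  have hdiff : ∫ x in K, (Q x 1 - Q x 0) ∂μ = 0 := by
    have : ∀ x ∈ K, Q x 1 - Q x 0 = ∫ t in Ioc (0 : ℝ) 1, D x t := by
      intro x hx
      rw [← intervalIntegral.integral_of_le zero_le_one,
        intervalIntegral.integral_eq_sub_of_hasDerivAt (fun t _ => hQD x t)]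
      refine ContinuousOn.intervalIntegrable ?_
      rw [uIcc_of_le zero_le_one]
      exact cD.comp (f := fun t : ℝ => (x, t)) (by fun_prop) fun t ht => ⟨hx, ht⟩
    rw [setIntegral_congr_fun hK.measurableSet this, integral_integral_swap hDint]
    exact setIntegral_eq_zero_of_forall_eq_zero fun t ht => hzero t (Ioc_subset_Icc_self ht)
  have h01 : (0 : ℝ) ∈ Icc (0 : ℝ) 1 := by simp
  have h11 : (1 : ℝ) ∈ Icc (0 : ℝ) 1 := by simp
  rw [integral_sub (hQint 1 h11) (hQint 0 h01), sub_eq_zero, ← hVK, ← hVK] at hdiff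
  · refine Eq.trans ?_ (hdiff.trans ?_)
    · refine setIntegral_congr_fun hV.measurableSet fun x hx => ?_
      have e := hfd 1 x hx
      simp only [one_smul] at e
      simp only [hQ, detAlt_comp_basis, one_smul]
      rw [e]
    · refine setIntegral_congr_fun hV.measurableSet fun x hx => ?_
      simp only [hQ, detAlt_comp_basis, zero_smul, add_zero]
  · intro x hx hxK
    simp [hQ, hφ0 0 h01 x hx hxK, - zero_smul]
  · intro x hx hxK
    simp [hQ, hφ0 1 h11 x hx hxK, - one_smul]

end

/-! ### Localization of the integral at the zeros -/

section

variable {E : Type*} [NormedAddCommGroup E] [NormedSpace ℝ E]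

theorem exists_pos_le_norm {X F : Type*} [TopologicalSpace X] [NormedAddCommGroup F] {C : Set X}
    (hC : IsCompact C) {G : X → F} (hG : ContinuousOn G C) (h0 : ∀ x ∈ C, G x ≠ 0) :
    ∃ δ > 0, ∀ x ∈ C, δ ≤ ‖G x‖ := by
  rcases C.eq_empty_or_nonempty with rfl | hne
  · exact ⟨1, one_pos, by simp⟩
  · obtain ⟨x, hx, hmin⟩ := hC.exists_isMinOn hne hG.norm
    exact ⟨‖G x‖, norm_pos_iff.2 (h0 x hx), fun y hy => hmin hy⟩

theorem exists_isOpen_injOn_sign_eq [FiniteDimensional ℝ E] {V N : Set E} (hV : IsOpen V)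
    {G : E → E} (hG : ContDiffOn ℝ ∞ G V) {x : E} (hx : x ∈ V) (hN : N ∈ 𝓝 x)
    (hdet : (fderiv ℝ G x).det ≠ 0) :
    ∃ U, IsOpen U ∧ x ∈ U ∧ U ⊆ V ∩ N ∧ InjOn G U ∧ G '' U ∈ 𝓝 (G x) ∧
      ∀ y ∈ U, SignType.sign (fderiv ℝ G y).det = SignType.sign (fderiv ℝ G x).det := by
  have hGx := hG.contDiffAt (hV.mem_nhds hx)
  have hstrict : HasStrictFDerivAt G
      ((fderiv ℝ G x).toContinuousLinearEquivOfDetNeZero hdet : E →L[ℝ] E) x := by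
    rw [ContinuousLinearMap.coe_toContinuousLinearEquivOfDetNeZero]
    exact hGx.hasStrictFDerivAt (by simp)
  have hcont : ContinuousAt (fun y => (fderiv ℝ G y).det) x :=
    ContinuousLinearMap.continuous_det.continuousAt.comp
      ((hG.continuousOn_fderiv_of_isOpen hV (by simp)).continuousAt (hV.mem_nhds hx))
  have hsign : ∀ᶠ y in 𝓝 x,
      SignType.sign (fderiv ℝ G y).det = SignType.sign (fderiv ℝ G x).det := by
    have : ContinuousAt (fun y => SignType.sign (fderiv ℝ G y).det) x :=
      ContinuousAt.comp (g := SignType.sign) (f := fun y => (fderiv ℝ G y).det)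
        (continuousAt_sign_of_ne_zero hdet) hcont
    exact this.eventually (IsOpen.mem_nhds (isOpen_discrete {_}) (mem_singleton _))
  obtain ⟨U, hU, hUo, hxU⟩ := eventually_nhds_iff.1
    (((hV.eventually_mem hx).and hN).and
      (hsign.and ((hstrict.toOpenPartialHomeomorph G).open_source.eventually_mem
        hstrict.mem_toOpenPartialHomeomorph_source)))
  refine ⟨U, hUo, hxU, fun y hy => (hU y hy).1, ?_, ?_, fun y hy => (hU y hy).2.1⟩
  · exact (hstrict.toOpenPartialHomeomorph G).injOn.mono fun y hy => (hU y hy).2.2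
  · rw [← hstrict.map_nhds_eq_of_equiv]
    exact image_mem_map (hUo.mem_nhds hxU)

/-- The zeros form a compact set, and the inverse function theorem isolates each of them. -/
theorem finite_zeros [FiniteDimensional ℝ E] {V : Set E}
    (hV : IsOpen V) (hVc : IsCompact (closure V)) {G : E → E}
    (hGc : ContinuousOn G (closure V)) (hG : ContDiffOn ℝ ∞ G V)
    (hfr : ∀ x ∈ frontier V, G x ≠ 0) (hreg : ∀ x ∈ V, G x = 0 → (fderiv ℝ G x).det ≠ 0) :
    (V ∩ G ⁻¹' {0}).Finite := by
  have hS : IsCompact (closure V ∩ G ⁻¹' {0}) := hVc.of_isClosed_subset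
    (hGc.preimage_isClosed_of_isClosed isClosed_closure isClosed_singleton) inter_subset_left
  have hSV : ∀ x ∈ closure V ∩ G ⁻¹' {0}, x ∈ V := by
    intro x hx
    by_contra hxV
    exact hfr x ⟨hx.1, by rwa [hV.interior_eq]⟩ hx.2
  have hloc : ∀ x ∈ closure V ∩ G ⁻¹' {0}, ∃ U ∈ 𝓝 x, InjOn G U := by
    intro x hx
    obtain ⟨U, hUo, hxU, -, hinj, -⟩ := exists_isOpen_injOn_sign_eq hV hG (hSV x hx) univ_mem
      (hreg x (hSV x hx) hx.2)
    exact ⟨U, hUo.mem_nhds hxU, hinj⟩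
  choose! U hU hinj using hloc
  obtain ⟨t, ht, htU⟩ := hS.elim_nhds_subcover U hU
  refine t.finite_toSet.subset fun y hy => ?_
  obtain ⟨x, hxt, hyx⟩ := mem_iUnion₂.1 (htU ⟨subset_closure hy.1, hy.2⟩)
  have hx := ht x hxt
  have : y = x := hinj x hx hyx (mem_of_mem_nhds (hU x hx)) (by rw [hy.2, hx.2])
  exact this ▸ hxt

/-- The integral `∫ φ(G) det G'`, for `φ` concentrated near the regular value `0`, is the sum of
the indices of the zeros of `G`. -/
theorem eventually_setIntegral_eq_finsum [FiniteDimensional ℝ E] [MeasurableSpace E] [BorelSpace E]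
    (μ : Measure E) [μ.IsAddHaarMeasure] {V : Set E}
    (hV : IsOpen V) (hVc : IsCompact (closure V)) {G : E → E}
    (hGc : ContinuousOn G (closure V)) (hG : ContDiffOn ℝ ∞ G V)
    (hfr : ∀ x ∈ frontier V, G x ≠ 0) (hreg : ∀ x ∈ V, G x = 0 → (fderiv ℝ G x).det ≠ 0) :
    ∀ᶠ δ in 𝓝[>] (0 : ℝ), ∀ φ : E → ℝ, Continuous φ → Function.support φ ⊆ Metric.ball 0 δ →
      ∫ x, φ x ∂μ = 1 → ∫ x in V, φ (G x) * (fderiv ℝ G x).det ∂μ =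
        ((∑ᶠ x ∈ V ∩ G ⁻¹' {0}, (SignType.sign (fderiv ℝ G x).det : ℤ) : ℤ) : ℝ) := by
  have hfin := finite_zeros hV hVc hGc hG hfr hreg
  obtain ⟨N, hN, hNd⟩ := hfin.t2_separation
  have hloc : ∀ x ∈ V ∩ G ⁻¹' {0}, ∃ U, IsOpen U ∧ x ∈ U ∧ U ⊆ V ∩ N x ∧ InjOn G U ∧
      G '' U ∈ 𝓝 (G x) ∧
      ∀ y ∈ U, SignType.sign (fderiv ℝ G y).det = SignType.sign (fderiv ℝ G x).det := fun x hx =>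
    exists_isOpen_injOn_sign_eq hV hG hx.1 ((hN x).2.mem_nhds (hN x).1) (hreg x hx.1 hx.2)
  choose! U hUo hxU hUN hinj himg hsign using hloc
  have hUV : ∀ x ∈ V ∩ G ⁻¹' {0}, U x ⊆ V := fun x hx y hy => (hUN x hx hy).1
  set O := ⋃ x ∈ V ∩ G ⁻¹' {0}, U x with hO
  have hOo : IsOpen O := isOpen_biUnion hUo
  have hOV : O ⊆ V := iUnion₂_subset hUV
  -- Away from the chosen neighbourhoods of the zeros, G is bounded away from 0; a φ supported in a
  -- smaller ball sees nothing there.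
  obtain ⟨δ₁, hδ₁, hmin⟩ := exists_pos_le_norm (hVc.diff hOo) (hGc.mono sdiff_subset) (by
    rintro x ⟨hx, hxO⟩ h0
    by_cases hxV : x ∈ V
    · exact hxO (mem_biUnion (show x ∈ V ∩ G ⁻¹' {0} from ⟨hxV, h0⟩) (hxU x ⟨hxV, h0⟩))
    · exact hfr x ⟨hx, by rwa [hV.interior_eq]⟩ h0)
  have hball : ∀ᶠ δ in 𝓝[>] (0 : ℝ), ∀ x ∈ V ∩ G ⁻¹' {0}, Metric.ball 0 δ ⊆ G '' U x := by
    refine (hfin.eventually_all).2 fun x hx => ?_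
    have h := himg x hx
    rw [show G x = 0 from hx.2] at h
    obtain ⟨ε, hε, hsub⟩ := Metric.mem_nhds_iff.1 h
    filter_upwards [Ioo_mem_nhdsGT hε] with δ hδ
    exact (Metric.ball_subset_ball hδ.2.le).trans hsub
  filter_upwards [hball, Ioo_mem_nhdsGT hδ₁] with δ hδ hδδ φ hφ hsupp hone
  have hφ0 : ∀ x, δ ≤ ‖x‖ → φ x = 0 := by
    intro x hx
    by_contra hne
    have := hsupp hne
    rw [mem_ball_zero_iff] at this
    linarith
  set F : E → ℝ := fun x => φ (G x) * (fderiv ℝ G x).det with hF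
  have hFO : ∀ x ∈ V \ O, F x = 0 := fun x hx => by
    simp [hF, hφ0 (G x) (hδδ.2.le.trans (hmin x ⟨subset_closure hx.1, hx.2⟩))]
  set K := closure V ∩ G ⁻¹' Metric.closedBall 0 δ with hKd
  have hK : IsCompact K := hVc.of_isClosed_subset
    (hGc.preimage_isClosed_of_isClosed isClosed_closure Metric.isClosed_closedBall)
    inter_subset_left
  have hKV : K ⊆ V := by
    rintro x ⟨hx, hxδ⟩
    by_contra hxV
    have := hmin x ⟨hx, fun h => hxV (hOV h)⟩
    have h2 : ‖G x‖ ≤ δ := by simpa using hxδ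
    linarith [hδδ.2]
  have hFV : ContinuousOn F V := (hφ.comp_continuousOn hG.continuousOn).mul
    (ContinuousLinearMap.continuous_det.comp_continuousOn
      (hG.continuousOn_fderiv_of_isOpen hV (by simp)))
  have hFint : IntegrableOn F V μ := by
    refine ((hFV.mono hKV).integrableOn_compact hK).of_forall_sdiff_eq_zero hV.measurableSet ?_
    rintro x ⟨hx, hxK⟩
    have : δ < ‖G x‖ := by
      by_contra! hle
      exact hxK ⟨subset_closure hx, by simpa using hle⟩
    simp [hF, hφ0 _ this.le]
  rw [setIntegral_eq_of_subset_of_forall_sdiff_eq_zero hV.measurableSet hOV hFO,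
    finsum_mem_eq_finite_toFinset_sum _ hfin]
  have hO' : O = ⋃ x ∈ hfin.toFinset, U x := by simp [hO]
  rw [hO', integral_biUnion_finset]
  · push_cast
    refine Finset.sum_congr rfl fun x hx => ?_
    rw [hfin.mem_toFinset] at hx
    -- The image of `U x` contains the ball supporting φ, so this change of variables yields the
    -- full integral 1; the constant sign of the Jacobian on `U x` removes the absolute value.
    have hcv := integral_image_eq_integral_abs_det_fderiv_smul μ (hUo x hx).measurableSet
      (fun y hy => ((hG.contDiffAt (hV.mem_nhds (hUV x hx hy))).differentiableAt
        (by simp)).hasFDerivAt.hasFDerivWithinAt) (hinj x hx) φ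
    rw [setIntegral_eq_integral_of_forall_compl_eq_zero, hone] at hcv
    · have : ∀ y ∈ U x, F y = ((SignType.sign (fderiv ℝ G x).det : ℤ) : ℝ) *
          (|(fderiv ℝ G y).det| • φ (G y)) := by
        intro y hy
        rw [← hsign x hx y hy]
        have h1 := sign_mul_abs (fderiv ℝ G y).det
        have h2 : (((SignType.sign (fderiv ℝ G y).det : ℤ)) : ℝ) =
          ((SignType.sign (fderiv ℝ G y).det : SignType) : ℝ) := by simp
        rw [h2, smul_eq_mul, ← mul_assoc, h1, mul_comm]
      rw [setIntegral_congr_fun (hUo x hx).measurableSet this, integral_const_mul, ← hcv, mul_one]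
      simp
    · intro y hy
      refine hφ0 y ?_
      by_contra! hlt
      exact hy (hδ x hx (by simpa using hlt))
  · intro x hx
    exact (hUo x (by simpa using hx)).measurableSet
  · intro x hx y hy hxy
    rw [hfin.coe_toFinset] at hx hy
    exact (hNd hx hy hxy).mono (fun z hz => (hUN x hx hz).2) (fun z hz => (hUN y hy hz).2)
  · intro x hx
    exact hFint.mono_set (hUV x (by simpa using hx))

end

/-! ### Degree of admissible triples on bounded sets -/

section

variable {k : ℕ}

theorem surjective_iff_det_ne_zero {E : Type*} [NormedAddCommGroup E] [NormedSpace ℝ E]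
    [FiniteDimensional ℝ E] (A : E →L[ℝ] E) : Function.Surjective A ↔ A.det ≠ 0 := by
  have h1 := LinearMap.isUnit_iff_range_eq_top (A : E →ₗ[ℝ] E)
  rw [LinearMap.isUnit_iff_isUnit_det, LinearMap.range_eq_top, isUnit_iff_ne_zero] at h1
  exact h1.symm

theorem IsSmoothOn.contDiffOn {g : EuclideanSpace ℝ (Fin k) → EuclideanSpace ℝ (Fin k)}
    {V : Set (EuclideanSpace ℝ (Fin k))} (h : IsSmoothOn g (closure V)) : ContDiffOn ℝ ∞ g V := by
  obtain ⟨O, F, -, hVO, hF, hgF⟩ := h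
  exact (hF.mono (subset_closure.trans hVO)).congr fun x hx => hgF (subset_closure hx)

theorem regularDegree_eq_finsum (g : EuclideanSpace ℝ (Fin k) → EuclideanSpace ℝ (Fin k))
    (V : Set (EuclideanSpace ℝ (Fin k))) (z : EuclideanSpace ℝ (Fin k)) :
    regularDegree g V z = ∑ᶠ x ∈ V ∩ (fun x => g x - z) ⁻¹' {0},
      (SignType.sign (fderiv ℝ (fun x => g x - z) x).det : ℤ) := by
  have : (fun x => g x - z) ⁻¹' {0} = g ⁻¹' {z} := by
    ext x; simp [sub_eq_zero]
  rw [this, regularDegree]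
  simp only [index, fderiv_sub_const]

theorem lt_norm_of_ofReal_lt_infEDist {f : EuclideanSpace ℝ (Fin k) → EuclideanSpace ℝ (Fin k)}
    {S : Set (EuclideanSpace ℝ (Fin k))} {y : EuclideanSpace ℝ (Fin k)} {m : ℝ}
    (h : ENNReal.ofReal m < Metric.infEDist y (f '' S)) {x : EuclideanSpace ℝ (Fin k)}
    (hx : x ∈ S) : m < ‖f x - y‖ := by
  have h1 := h.trans_le (Metric.infEDist_le_edist_of_mem (mem_image_of_mem f hx))
  rw [edist_dist, dist_comm, dist_eq_norm] at h1
  exact (ENNReal.ofReal_lt_ofReal_iff').1 h1 |>.1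

/-- On the frontier, g - z lies in the open ball about f - y whose bounding sphere passes through 0.
-/
theorem IsRegularApprox.norm_sub_lt {f g : EuclideanSpace ℝ (Fin k) → EuclideanSpace ℝ (Fin k)}
    {V : Set (EuclideanSpace ℝ (Fin k))} {y z : EuclideanSpace ℝ (Fin k)}
    (h : IsRegularApprox f V y g z) {x : EuclideanSpace ℝ (Fin k)} (hx : x ∈ frontier V) :
    ‖(g x - z) - (f x - y)‖ < ‖f x - y‖ := by
  obtain ⟨-, ε, σ, -, -, hg, hz, hd⟩ := h
  have h1 := lt_norm_of_ofReal_lt_infEDist hd hx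
  have h2 := hg x (frontier_subset_closure hx)
  have h3 : (g x - z) - (f x - y) = (g x - f x) - (z - y) := by abel
  rw [h3]
  linarith [norm_sub_le (g x - f x) (z - y)]

theorem IsRegularApprox.regularDegree_eq
    {f g₀ g₁ : EuclideanSpace ℝ (Fin k) → EuclideanSpace ℝ (Fin k)}
    {V : Set (EuclideanSpace ℝ (Fin k))} (hVc : IsCompact (closure V))
    {y z₀ z₁ : EuclideanSpace ℝ (Fin k)}
    (h₀ : IsRegularApprox f V y g₀ z₀) (h₁ : IsRegularApprox f V y g₁ z₁) :
    regularDegree g₀ V z₀ = regularDegree g₁ V z₁ := by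
  have hV := h₀.1.admissible.isOpen
  have hdata : ∀ g z, IsRegularApprox f V y g z →
      ContinuousOn (fun x => g x - z) (closure V) ∧ ContDiffOn ℝ ∞ (fun x => g x - z) V ∧
      (∀ x ∈ frontier V, g x - z ≠ 0) ∧
      ∀ x ∈ V, g x - z = 0 → (fderiv ℝ (fun x => g x - z) x).det ≠ 0 := by
    intro g z h
    refine ⟨h.1.admissible.proper.1.sub continuousOn_const,
      h.1.smooth.contDiffOn.sub contDiffOn_const,
      fun x hx => sub_ne_zero.2 (h.1.admissible.ne_frontier x hx), fun x hx h0 => ?_⟩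
    rw [fderiv_sub_const]
    exact (surjective_iff_det_ne_zero _).1 (h.1.regular x hx (sub_eq_zero.1 h0))
  obtain ⟨c₀, s₀, n₀, r₀⟩ := hdata g₀ z₀ h₀
  obtain ⟨c₁, s₁, n₁, r₁⟩ := hdata g₁ z₁ h₁
  set f' : EuclideanSpace ℝ (Fin k) → EuclideanSpace ℝ (Fin k) := fun x => g₀ x - z₀ with hf'
  set h : EuclideanSpace ℝ (Fin k) → EuclideanSpace ℝ (Fin k) :=
    fun x => (g₁ x - z₁) - (g₀ x - z₀) with hh
  have hfc : IsCompact (frontier V) :=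
    hVc.of_isClosed_subset isClosed_frontier frontier_subset_closure
  obtain ⟨δ₂, hδ₂, hmin⟩ := exists_pos_le_norm (hfc.prod (isCompact_Icc (a := (0 : ℝ)) (b := 1)))
    (G := fun p : EuclideanSpace ℝ (Fin k) × ℝ => f' p.1 + p.2 • h p.1) (by
      have e₀ : ContinuousOn (fun p : EuclideanSpace ℝ (Fin k) × ℝ => g₀ p.1 - z₀)
          (frontier V ×ˢ Icc (0 : ℝ) 1) :=
        c₀.comp continuousOn_fst fun p hp => frontier_subset_closure hp.1
      have e₁ : ContinuousOn (fun p : EuclideanSpace ℝ (Fin k) × ℝ => g₁ p.1 - z₁)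
          (frontier V ×ˢ Icc (0 : ℝ) 1) :=
        c₁.comp continuousOn_fst fun p hp => frontier_subset_closure hp.1
      exact e₀.add (continuousOn_snd.smul (e₁.sub e₀))) (by
      rintro ⟨x, t⟩ ⟨hx, ht⟩ h0
      have l₀ := h₀.norm_sub_lt hx
      have l₁ := h₁.norm_sub_lt hx
      -- Both endpoints lie in a ball that is convex and misses 0, hence so does the segment between
      -- them.
      have hb := (convex_ball (f x - y) ‖f x - y‖) (x := g₀ x - z₀) (y := g₁ x - z₁)
        (by rwa [mem_ball_iff_norm]) (by rwa [mem_ball_iff_norm])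
        (sub_nonneg.2 ht.2) ht.1 (by simp)
      have : (1 - t) • (g₀ x - z₀) + t • (g₁ x - z₁) = 0 := by
        rw [← h0]
        simp only [hf', hh, sub_smul, one_smul, smul_sub]
        abel
      rw [this] at hb
      rw [mem_ball_iff_norm, zero_sub, norm_neg] at hb
      exact hb.false)
  have ev₀ := eventually_setIntegral_eq_finsum volume hV hVc c₀ s₀ n₀ r₀
  have ev₁ := eventually_setIntegral_eq_finsum volume hV hVc c₁ s₁ n₁ r₁
  obtain ⟨δ, hi₀, hi₁, hδ⟩ := (ev₀.and (ev₁.and (Ioo_mem_nhdsGT hδ₂))).exists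
  -- A single bump serves both localizations and, as δ < δ₂, also the homotopy on the frontier.
  let B : ContDiffBump (0 : EuclideanSpace ℝ (Fin k)) := ⟨δ / 2, δ, half_pos hδ.1, half_lt_self hδ.1⟩
  have hsupp : Function.support (B.normed volume) ⊆ Metric.ball 0 δ := B.support_normed_eq.subset
  have I₀ := hi₀ _ B.continuous_normed hsupp B.integral_normed
  have I₁ := hi₁ _ B.continuous_normed hsupp B.integral_normed
  have hom := setIntegral_homotopy volume (EuclideanSpace.basisFun (Fin k) ℝ).toBasis hV hVc c₀
    (c₁.sub c₀) s₀ (s₁.sub s₀) (φ := B.normed volume) B.contDiff_normed (by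
      intro t ht x hx hmem
      rw [B.tsupport_normed_eq, mem_closedBall_zero_iff] at hmem
      have h1 := hmin (x, t) ⟨hx, ht⟩
      have h2 : ‖f' x + t • h x‖ ≤ δ := hmem
      have h3 := h1.trans h2
      linarith [hδ.2])
  simp only [Pi.sub_apply, add_sub_cancel] at hom
  rw [regularDegree_eq_finsum, regularDegree_eq_finsum]
  have : (_ : ℝ) = _ := I₀.symm.trans (hom.symm.trans I₁)
  exact_mod_cast this

/-- Tietze extension to the whole space, smooth approximation, then Sard: the critical values are a
null set, so they cannot fill a ball around y. -/
theorem exists_smooth_regular_approx {f : EuclideanSpace ℝ (Fin k) → EuclideanSpace ℝ (Fin k)}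
    {C : Set (EuclideanSpace ℝ (Fin k))} (hC : IsClosed C) (hf : ContinuousOn f C)
    (y : EuclideanSpace ℝ (Fin k)) {η : ℝ} (hη : 0 < η) :
    ∃ g z, ContDiff ℝ ∞ g ∧ (∀ x ∈ C, ‖g x - f x‖ < η) ∧ ‖z - y‖ < η ∧
      ∀ x, g x = z → Function.Surjective (fderiv ℝ g x) := by
  obtain ⟨F, hF⟩ := ContinuousMap.exists_restrict_eq hC ⟨C.domRestrict f, hf.domRestrict⟩
  have hFf : ∀ x ∈ C, F x = f x := fun x hx => DFunLike.congr_fun hF ⟨x, hx⟩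
  obtain ⟨g, hg, hgF, -⟩ := F.continuous.exists_contDiff_approx (ε := fun _ => η) ⊤
    continuous_const fun _ => hη
  have hsard := addHaar_image_eq_zero_of_det_fderivWithin_eq_zero
    (volume : Measure (EuclideanSpace ℝ (Fin k))) (s := {x | (fderiv ℝ g x).det = 0}) (f := g)
    (f' := fderiv ℝ g)
    (fun x _ => ((hg.differentiable (by simp)) x).hasFDerivAt.hasFDerivWithinAt) fun x hx => hx
  obtain ⟨z, hz, hzg⟩ : ∃ z ∈ Metric.ball y η, z ∉ g '' {x | (fderiv ℝ g x).det = 0} := by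
    by_contra! hcon
    exact (Metric.measure_ball_pos volume y hη).ne' (measure_mono_null hcon hsard)
  refine ⟨g, z, hg, fun x hx => ?_, by rwa [mem_ball_iff_norm] at hz, fun x hx => ?_⟩
  · rw [← hFf x hx, ← dist_eq_norm]
    exact hgF x
  · exact (surjective_iff_det_ne_zero _).2 fun h0 => hzg ⟨x, h0, hx⟩

theorem isRegularApprox_of_margin {f g : EuclideanSpace ℝ (Fin k) → EuclideanSpace ℝ (Fin k)}
    {V : Set (EuclideanSpace ℝ (Fin k))} (hV : IsOpen V) (hVc : IsCompact (closure V))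
    {y z : EuclideanSpace ℝ (Fin k)} {ε σ m : ℝ} (hε : 0 < ε) (hσ : 0 < σ) (hm : ε + σ < m)
    (hf : ∀ x ∈ frontier V, m ≤ ‖f x - y‖) (hg : ContDiff ℝ ∞ g)
    (hgf : ∀ x ∈ closure V, ‖g x - f x‖ ≤ ε) (hz : ‖z - y‖ ≤ σ)
    (hreg : ∀ x, g x = z → Function.Surjective (fderiv ℝ g x)) :
    IsRegularApprox f V y g z := by
  refine ⟨⟨⟨hV, ⟨hg.continuous.continuousOn, fun K hK => ?_⟩, fun x hx hxz => ?_⟩,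
    ⟨univ, g, isOpen_univ, subset_univ _, hg.contDiffOn, fun _ _ => rfl⟩, fun x _ => hreg x⟩,
    ε, σ, hε, hσ, hgf, hz, ?_⟩
  · exact hVc.inter_right (hK.isClosed.preimage hg.continuous)
  · have h1 := hgf x (frontier_subset_closure hx)
    have h2 := hf x hx
    have h3 : f x - y = (z - y) - (g x - f x) := by rw [hxz]; abel
    rw [h3] at h2
    linarith [norm_sub_le (z - y) (g x - f x)]
  · refine ((ENNReal.ofReal_lt_ofReal_iff (by linarith)).2 hm).trans_le (Metric.le_infEDist.2 ?_)
    rintro _ ⟨x, hx, rfl⟩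
    rw [edist_dist, dist_comm, dist_eq_norm]
    exact ENNReal.ofReal_le_ofReal (hf x hx)

theorem exists_hasAdmissibleDegree {f : EuclideanSpace ℝ (Fin k) → EuclideanSpace ℝ (Fin k)}
    {V : Set (EuclideanSpace ℝ (Fin k))} (hV : IsOpen V) (hVc : IsCompact (closure V))
    (hf : ContinuousOn f (closure V)) {y : EuclideanSpace ℝ (Fin k)}
    (hy : ∀ x ∈ frontier V, f x ≠ y) : ∃ d, HasAdmissibleDegree f V y d := by
  obtain ⟨m, hm, hmin⟩ := exists_pos_le_norm (G := fun x => f x - y)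
    (hVc.of_isClosed_subset isClosed_frontier frontier_subset_closure)
    ((hf.mono frontier_subset_closure).sub continuousOn_const) fun x hx => sub_ne_zero.2 (hy x hx)
  obtain ⟨g, z, hg, hgf, hz, hreg⟩ := exists_smooth_regular_approx isClosed_closure hf y
    (show 0 < m / 3 by linarith)
  have happ : IsRegularApprox f V y g z :=
    isRegularApprox_of_margin hV hVc (ε := m / 3) (σ := m / 3) (by linarith) (by linarith)
      (by linarith) hmin hg (fun x hx => (hgf x hx).le) hz.le hreg
  refine ⟨regularDegree g V z, ⟨hV, ⟨hf, fun K hK => ?_⟩, hy⟩, ⟨g, z, happ⟩,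
    fun g' z' h' => h'.regularDegree_eq hVc happ⟩
  exact hVc.of_isClosed_subset (hf.preimage_isClosed_of_isClosed isClosed_closure hK.isClosed)
    inter_subset_left

/-! ### Excision and stability of the admissible degree -/

theorem HasAdmissibleDegree.unique {f : EuclideanSpace ℝ (Fin k) → EuclideanSpace ℝ (Fin k)}
    {V : Set (EuclideanSpace ℝ (Fin k))} {y : EuclideanSpace ℝ (Fin k)} {d e : ℤ}
    (hd : HasAdmissibleDegree f V y d) (he : HasAdmissibleDegree f V y e) : d = e := by
  obtain ⟨g, z, hg⟩ := hd.2.1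
  exact (hd.2.2 g z hg).symm.trans (he.2.2 g z hg)

/-- The margin `m` is taken over the compact set closure V \ V', which contains both frontiers and
everything removed. One pair (g, z) within m / 3 therefore approximates on V and on V', and it has
no solutions in V \ V'. -/
theorem HasAdmissibleDegree.excision {f : EuclideanSpace ℝ (Fin k) → EuclideanSpace ℝ (Fin k)}
    {V V' : Set (EuclideanSpace ℝ (Fin k))} (hVc : IsCompact (closure V)) (hV' : IsOpen V')
    (hsub : V' ⊆ V) {y : EuclideanSpace ℝ (Fin k)} (hy : ∀ x ∈ closure V \ V', f x ≠ y) {d : ℤ}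
    (hd : HasAdmissibleDegree f V y d) : HasAdmissibleDegree f V' y d := by
  have hV := hd.1.isOpen
  have hf := hd.1.proper.1
  have hcl : closure V' ⊆ closure V := closure_mono hsub
  have hV'c : IsCompact (closure V') := hVc.of_isClosed_subset isClosed_closure hcl
  have hfr' : frontier V' ⊆ closure V \ V' := fun x hx =>
    ⟨hcl (frontier_subset_closure hx), fun h => hx.2 (by rwa [hV'.interior_eq])⟩
  have hfr : frontier V ⊆ closure V \ V' := fun x hx =>
    ⟨frontier_subset_closure hx, fun h => hx.2 (by rw [hV.interior_eq]; exact hsub h)⟩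
  obtain ⟨e, he⟩ := exists_hasAdmissibleDegree hV' hV'c (hf.mono hcl) fun x hx => hy x (hfr' hx)
  obtain ⟨m, hm, hmin⟩ := exists_pos_le_norm (G := fun x => f x - y) (hVc.diff hV')
    ((hf.mono sdiff_subset).sub continuousOn_const) fun x hx => sub_ne_zero.2 (hy x hx)
  obtain ⟨g, z, hg, hgf, hz, hreg⟩ := exists_smooth_regular_approx isClosed_closure hf y
    (show 0 < m / 3 by linarith)
  have h1 : IsRegularApprox f V y g z :=
    isRegularApprox_of_margin hV hVc (ε := m / 3) (σ := m / 3) (by linarith) (by linarith)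
      (by linarith) (fun x hx => hmin x (hfr hx)) hg (fun x hx => (hgf x hx).le) hz.le hreg
  have h2 : IsRegularApprox f V' y g z :=
    isRegularApprox_of_margin hV' hV'c (ε := m / 3) (σ := m / 3) (by linarith) (by linarith)
      (by linarith) (fun x hx => hmin x (hfr' hx)) hg (fun x hx => (hgf x (hcl hx)).le) hz.le hreg
  have hset : V ∩ g ⁻¹' {z} = V' ∩ g ⁻¹' {z} := by
    refine Subset.antisymm ?_ (inter_subset_inter_left _ hsub)
    rintro x ⟨hx, hxz⟩
    refine ⟨?_, hxz⟩
    by_contra hxV'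
    have hgz : g x = z := hxz
    have l1 := hmin x ⟨subset_closure hx, hxV'⟩
    have l2 := hgf x (subset_closure hx)
    have l3 : f x - y = (z - y) - (g x - f x) := by rw [hgz]; abel
    rw [l3] at l1
    linarith [norm_sub_le (z - y) (g x - f x)]
  have : d = e := by
    rw [← hd.2.2 g z h1, ← he.2.2 g z h2, regularDegree, regularDegree, hset]
  exact this ▸ he

/-- Both triples share a regular approximation. Moving the map and the value by less than m / 8
leaves a frontier margin of 3m / 4 for `f₁`; an approximation within m / 8 of the first triple is
within m / 4 of the second, and m / 4 + m / 4 < 3m / 4. -/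
theorem HasAdmissibleDegree.of_close {f₀ f₁ : EuclideanSpace ℝ (Fin k) → EuclideanSpace ℝ (Fin k)}
    {V : Set (EuclideanSpace ℝ (Fin k))} (hVc : IsCompact (closure V))
    (hf₁ : ContinuousOn f₁ (closure V)) {y₀ y₁ : EuclideanSpace ℝ (Fin k)} {m : ℝ} (hm : 0 < m)
    (hmin : ∀ x ∈ frontier V, m ≤ ‖f₀ x - y₀‖) (hff : ∀ x ∈ closure V, ‖f₁ x - f₀ x‖ < m / 8)
    (hyy : ‖y₁ - y₀‖ < m / 8) {d : ℤ} (hd : HasAdmissibleDegree f₀ V y₀ d) :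
    HasAdmissibleDegree f₁ V y₁ d := by
  have hV := hd.1.isOpen
  have hmin₁ : ∀ x ∈ frontier V, 3 / 4 * m ≤ ‖f₁ x - y₁‖ := by
    intro x hx
    have l1 := hmin x hx
    have l2 := hff x (frontier_subset_closure hx)
    have l3 : f₀ x - y₀ = (f₁ x - y₁) - (f₁ x - f₀ x) + (y₁ - y₀) := by abel
    rw [l3] at l1
    linarith [norm_add_le ((f₁ x - y₁) - (f₁ x - f₀ x)) (y₁ - y₀),
      norm_sub_le (f₁ x - y₁) (f₁ x - f₀ x)]
  obtain ⟨e, he⟩ := exists_hasAdmissibleDegree hV hVc hf₁ (y := y₁) fun x hx h0 => by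
    have := hmin₁ x hx
    rw [h0, sub_self, norm_zero] at this
    linarith
  obtain ⟨g, z, hg, hgf, hz, hreg⟩ := exists_smooth_regular_approx isClosed_closure hd.1.proper.1 y₀
    (show 0 < m / 8 by linarith)
  have h₀ : IsRegularApprox f₀ V y₀ g z :=
    isRegularApprox_of_margin hV hVc (ε := m / 8) (σ := m / 8) (by linarith) (by linarith)
      (by linarith) hmin hg (fun x hx => (hgf x hx).le) hz.le hreg
  have h₁ : IsRegularApprox f₁ V y₁ g z :=
    isRegularApprox_of_margin hV hVc (ε := m / 4) (σ := m / 4) (by linarith) (by linarith)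
      (by linarith) hmin₁ hg (fun x hx => by
        have l1 := hgf x hx
        have l2 := hff x hx
        have l3 : g x - f₁ x = (g x - f₀ x) - (f₁ x - f₀ x) := by abel
        rw [l3]
        linarith [norm_sub_le (g x - f₀ x) (f₁ x - f₀ x)]) (by
        have l3 : z - y₁ = (z - y₀) - (y₁ - y₀) := by abel
        rw [l3]
        linarith [norm_sub_le (z - y₀) (y₁ - y₀)]) hreg
  have : d = e := by rw [← hd.2.2 g z h₀, ← he.2.2 g z h₁]
  exact this ▸ he

/-! ### Weakly admissible triples and local constancy in the parameter -/

theorem IsSolutionNhd.isCompact_closure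
    {f : EuclideanSpace ℝ (Fin k) → EuclideanSpace ℝ (Fin k)}
    {U V : Set (EuclideanSpace ℝ (Fin k))} {y : EuclideanSpace ℝ (Fin k)}
    (hV : IsSolutionNhd f U y V) : IsCompact (closure V) :=
  hV.2.1.isCompact_closure

theorem IsSolutionNhd.ne {f : EuclideanSpace ℝ (Fin k) → EuclideanSpace ℝ (Fin k)}
    {U V : Set (EuclideanSpace ℝ (Fin k))} {y : EuclideanSpace ℝ (Fin k)}
    (hV : IsSolutionNhd f U y V) {x : EuclideanSpace ℝ (Fin k)} (hx : x ∈ U) (hxV : x ∉ V) :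
    f x ≠ y := fun h => hxV (hV.2.2.1 ⟨hx, h⟩)

theorem IsSolutionNhd.ne_of_mem_frontier
    {f : EuclideanSpace ℝ (Fin k) → EuclideanSpace ℝ (Fin k)}
    {U V : Set (EuclideanSpace ℝ (Fin k))} {y : EuclideanSpace ℝ (Fin k)}
    (hV : IsSolutionNhd f U y V) {x : EuclideanSpace ℝ (Fin k)} (hx : x ∈ frontier V) :
    f x ≠ y :=
  hV.ne (hV.2.2.2 (frontier_subset_closure hx)) fun h => hx.2 (by rwa [hV.1.interior_eq])

theorem IsWeaklyAdmissible.exists_isSolutionNhd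
    {f : EuclideanSpace ℝ (Fin k) → EuclideanSpace ℝ (Fin k)}
    {U : Set (EuclideanSpace ℝ (Fin k))} {y : EuclideanSpace ℝ (Fin k)}
    (h : IsWeaklyAdmissible f U y) : ∃ V, IsSolutionNhd f U y V := by
  obtain ⟨V, hV, hSV, hVU, hVc⟩ := exists_open_between_and_isCompact_closure h.compact h.isOpen
    inter_subset_left
  exact ⟨V, hV, hVc.isBounded.subset subset_closure, hSV, hVU⟩

/-- The degree of a weakly admissible triple is well defined. -/
theorem IsWeaklyAdmissible.exists_hasDegree
    {f : EuclideanSpace ℝ (Fin k) → EuclideanSpace ℝ (Fin k)}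
    {U : Set (EuclideanSpace ℝ (Fin k))} {y : EuclideanSpace ℝ (Fin k)}
    (h : IsWeaklyAdmissible f U y) : ∃ d, HasDegree f U y d := by
  have hex : ∀ V, IsSolutionNhd f U y V → ∃ d, HasAdmissibleDegree f V y d := fun V hV =>
    exists_hasAdmissibleDegree hV.1 hV.isCompact_closure (h.continuousOn.mono hV.2.2.2)
      fun x hx => hV.ne_of_mem_frontier hx
  obtain ⟨V₀, hV₀⟩ := h.exists_isSolutionNhd
  obtain ⟨d, hd⟩ := hex V₀ hV₀
  refine ⟨d, h, ⟨V₀, hV₀⟩, fun V hV => ?_⟩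
  obtain ⟨e, he⟩ := hex V hV
  have hne : ∀ x ∈ U, x ∉ V ∩ V₀ → f x ≠ y := fun x hx hn h0 =>
    hn ⟨hV.2.2.1 ⟨hx, h0⟩, hV₀.2.2.1 ⟨hx, h0⟩⟩
  -- Two neighbourhoods need not be nested, so both are compared with their intersection.
  have e1 := he.excision hV.isCompact_closure (hV.1.inter hV₀.1) inter_subset_left
    fun x hx => hne x (hV.2.2.2 hx.1) hx.2
  have d1 := hd.excision hV₀.isCompact_closure (hV.1.inter hV₀.1) inter_subset_right
    fun x hx => hne x (hV₀.2.2.2 hx.1) hx.2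
  exact e1.unique d1 ▸ he

/-- A solution neighbourhood V at `t₀` remains one for nearby t, and on its closure the maps and the
values are uniformly close, so `HasAdmissibleDegree.of_close` applies. -/
theorem HasDegree.eventually_eq
    {W : Set (EuclideanSpace ℝ (Fin k) × unitInterval)} (hW : IsOpen W)
    {H : EuclideanSpace ℝ (Fin k) × unitInterval → EuclideanSpace ℝ (Fin k)}
    (hH : ContinuousOn H W)
    {α : unitInterval → EuclideanSpace ℝ (Fin k)} (hα : Continuous α)
    (hcpt : IsCompact {p : EuclideanSpace ℝ (Fin k) × unitInterval | p ∈ W ∧ H p = α p.2})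
    {t₀ : unitInterval} {d : ℤ} (hd : HasDegree (fun x => H (x, t₀)) (slice W t₀) (α t₀) d) :
    ∀ᶠ t in 𝓝 t₀, ∀ e, HasDegree (fun x => H (x, t)) (slice W t) (α t) e → e = d := by
  obtain ⟨V, hV⟩ := hd.2.1
  have hdV := hd.2.2 V hV
  have hVc := hV.isCompact_closure
  obtain ⟨m, hm, hmin⟩ := exists_pos_le_norm (G := fun x => H (x, t₀) - α t₀)
    (hVc.of_isClosed_subset isClosed_frontier frontier_subset_closure)
    ((hdV.1.proper.1.mono frontier_subset_closure).sub continuousOn_const)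
    fun x hx => sub_ne_zero.2 (hV.ne_of_mem_frontier hx)
  have hswap : ∀ x, Tendsto (fun z : unitInterval × EuclideanSpace ℝ (Fin k) => (z.2, z.1))
      (𝓝 (t₀, x)) (𝓝 (x, t₀)) := fun x => continuous_swap.tendsto _
  have ev1 : ∀ᶠ t in 𝓝 t₀, ∀ x ∈ closure V, (x, t) ∈ W :=
    hVc.eventually_forall_of_forall_eventually fun x hx =>
      (hswap x).eventually (hW.eventually_mem (hV.2.2.2 hx))
  have ev2 : ∀ᶠ t in 𝓝 t₀, ∀ x ∈ closure V, ‖H (x, t) - H (x, t₀)‖ < m / 8 := by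
    refine hVc.eventually_forall_of_forall_eventually fun x hx => ?_
    have hx0 : ContinuousAt H (x, t₀) := hH.continuousAt (hW.mem_nhds (hV.2.2.2 hx))
    have c1 : Tendsto (fun z : unitInterval × EuclideanSpace ℝ (Fin k) => H (z.2, z.1))
        (𝓝 (t₀, x)) (𝓝 (H (x, t₀))) := hx0.tendsto.comp (hswap x)
    have c2 : Tendsto (fun z : unitInterval × EuclideanSpace ℝ (Fin k) => H (z.2, t₀))
        (𝓝 (t₀, x)) (𝓝 (H (x, t₀))) := by
      refine hx0.tendsto.comp ?_
      have : Continuous fun z : unitInterval × EuclideanSpace ℝ (Fin k) => (z.2, t₀) := by fun_prop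
      exact this.tendsto (t₀, x)
    have c3 := (c1.sub c2).norm
    rw [sub_self, norm_zero] at c3
    exact c3.eventually_lt_const (by linarith)
  have ev3 : ∀ᶠ t in 𝓝 t₀, ‖α t - α t₀‖ < m / 8 := by
    have := ((hα.tendsto t₀).sub_const (α t₀)).norm
    rw [sub_self, norm_zero] at this
    exact this.eventually_lt_const (by linarith)
  -- Solutions cannot suddenly appear outside V: the part of the compact solution set outside V ×
  -- [0, 1] projects to a closed set of parameters, which misses `t₀`.
  have ev4 : ∀ᶠ t in 𝓝 t₀, slice W t ∩ (fun x => H (x, t)) ⁻¹' {α t} ⊆ V := by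
    have hB : IsCompact (Prod.snd ''
        ({p : EuclideanSpace ℝ (Fin k) × unitInterval | p ∈ W ∧ H p = α p.2} \ (V ×ˢ univ))) :=
      (hcpt.diff (hV.1.prod isOpen_univ)).image continuous_snd
    have ht₀ : t₀ ∉ Prod.snd ''
        ({p : EuclideanSpace ℝ (Fin k) × unitInterval | p ∈ W ∧ H p = α p.2} \ (V ×ˢ univ)) := by
      rintro ⟨⟨x, t⟩, ⟨⟨hx, hHx⟩, hxV⟩, rfl⟩
      exact hxV ⟨hV.2.2.1 ⟨hx, hHx⟩, mem_univ _⟩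
    filter_upwards [hB.isClosed.isOpen_compl.mem_nhds ht₀] with t ht x hx
    by_contra hxV
    exact ht ⟨(x, t), ⟨⟨hx.1, hx.2⟩, fun h => hxV h.1⟩, rfl⟩
  filter_upwards [ev1, ev2, ev3, ev4] with t h1 h2 h3 h4 e he
  have hVt : IsSolutionNhd (fun x => H (x, t)) (slice W t) (α t) V :=
    ⟨hV.1, hV.2.1, h4, h1⟩
  exact (he.2.2 V hVt).unique
    (hdV.of_close hVc (he.1.continuousOn.mono hVt.2.2.2) hm hmin h2 h3)

theorem isWeaklyAdmissible_slice
    {W : Set (EuclideanSpace ℝ (Fin k) × unitInterval)} (hW : IsOpen W)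
    {H : EuclideanSpace ℝ (Fin k) × unitInterval → EuclideanSpace ℝ (Fin k)}
    (hH : ContinuousOn H W) {α : unitInterval → EuclideanSpace ℝ (Fin k)}
    (hcpt : IsCompact {p : EuclideanSpace ℝ (Fin k) × unitInterval | p ∈ W ∧ H p = α p.2})
    (t : unitInterval) : IsWeaklyAdmissible (fun x => H (x, t)) (slice W t) (α t) := by
  have hc : Continuous fun x : EuclideanSpace ℝ (Fin k) => (x, t) := by fun_prop
  refine ⟨hW.preimage hc, hH.comp hc.continuousOn fun x hx => hx, ?_⟩
  have : slice W t ∩ (fun x => H (x, t)) ⁻¹' {α t} = Prod.fst ''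
      ({p : EuclideanSpace ℝ (Fin k) × unitInterval | p ∈ W ∧ H p = α p.2} ∩
        Prod.snd ⁻¹' {t}) := by
    ext x
    constructor
    · rintro ⟨hx, hHx⟩
      exact ⟨(x, t), ⟨⟨hx, hHx⟩, rfl⟩, rfl⟩
    · rintro ⟨⟨x, s⟩, ⟨⟨hx, hHx⟩, rfl⟩, rfl⟩
      exact ⟨hx, hHx⟩
  rw [this]
  exact (hcpt.inter_right (isClosed_singleton.preimage continuous_snd)).image continuous_fst

end

end BrouwerDeg

theorem mainTheorem11 (k : ℕ)
    (W : Set (EuclideanSpace ℝ (Fin k) × unitInterval)) (hW : IsOpen W)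
    (H : EuclideanSpace ℝ (Fin k) × unitInterval → EuclideanSpace ℝ (Fin k))
    (hH : ContinuousOn H W)
    (α : unitInterval → EuclideanSpace ℝ (Fin k)) (hα : Continuous α)
    (hcpt : IsCompact {p : EuclideanSpace ℝ (Fin k) × unitInterval | p ∈ W ∧ H p = α p.2}) :
    (∀ t : unitInterval,
      BrouwerDeg.HasDegree (fun x => H (x, t)) (BrouwerDeg.slice W t) (α t)
        (BrouwerDeg.degree (fun x => H (x, t)) (BrouwerDeg.slice W t) (α t))) ∧
    ∀ s t : unitInterval,
      BrouwerDeg.degree (fun x => H (x, s)) (BrouwerDeg.slice W s) (α s) =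
        BrouwerDeg.degree (fun x => H (x, t)) (BrouwerDeg.slice W t) (α t) := by
  have hdeg : ∀ t : unitInterval,
      BrouwerDeg.HasDegree (fun x => H (x, t)) (BrouwerDeg.slice W t) (α t)
        (BrouwerDeg.degree (fun x => H (x, t)) (BrouwerDeg.slice W t) (α t)) := by
    intro t
    obtain ⟨d, hd⟩ := (BrouwerDeg.isWeaklyAdmissible_slice hW hH hcpt t).exists_hasDegree
    rwa [hd.degree_eq]
  refine ⟨hdeg, fun s t => ?_⟩
  -- Connectedness of the unit interval turns local constancy into constancy.
  refine IsLocallyConstant.apply_eq_of_preconnectedSpace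
    (f := fun t => BrouwerDeg.degree (fun x => H (x, t)) (BrouwerDeg.slice W t) (α t)) ?_ s t
  rw [IsLocallyConstant.iff_eventually_eq]
  intro t₀
  filter_upwards [(hdeg t₀).eventually_eq hW hH hα hcpt] with t ht
  exact ht _ (hdeg t)
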